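/- All graphs are finite, simple and non-empty. A fractional colouring of a graph $G$ is a map $f$ from the set $\mathcal I(G)$ of independent sets of $G$ to $[0,1]$ with $\sum_{I \in \mathcal I(G),\, I \ni x} f(I) \ge 1$ for every vertex $x$ of $G$; the fractional chromatic number $\chi_f(G)$ is the minimum of $\sum_{I\in\mathcal I(G)} f(I)$ over all fractional colourings $f$ of $G$. For a positive integer $n$, the $n$th cone $\Delta_n(G)$ over $G$ has vertex set $(V(G)\times\{0,1,\dots,n-1\})\cup\{\star\}$ and edge set $\{(x,i)(y,j) : xy\in E(G),\ |i-j|=1 \text{ or } i=j=0\}\cup\{(x,n-1)\star : x\in V(G)\}$. For a graph $H$, the graph $\Delta_{H,n}(G)$ is obtained from the disjoint union of copies of $\Delta_n(G)$, one copy $\{(u,v) : u\in V(\Delta_n(G))\}$ for each $v\in V(H)$, by identifying, for each $x\in V(G)$, all the vertices $((x,0),v)$ with $v\in V(H)$ into a single vertex, and adding the edges $(\star,v)(\star,v')$ for all $vv'\in E(H)$. Theorem. Let $G$ and $H$ be graphs with $\chi_f(H)\le\chi_f(G)$, and let $n$ be a positive integer. Then $$\chi_f(\Delta_{H,n}(G))=\begin{cases}\chi_f(G)+\dfrac{1}{\sum_{k=0}^{n-1}(\chi_f(G)-1)^k}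 & \text{if } n \text{ is even},\\[3ex] \chi_f(G)+\dfrac{\chi_f(H)}{\chi_f(H)\sum_{k=0}^{n-1}(\chi_f(G)-1)^k+1-\chi_f(H)} & \text{if } n \text{ is odd},\end{cases}$$ where $0^0=1$. -/

import Mathlib

universe u v

namespace SimpleGraph

section Fractional

open Classical in
/-- The family of independent sets of a finite graph. -/
noncomputable def indepFamily {V : Type u} [Fintype V] (G : SimpleGraph V) :
    Finset (Finset V) :=
  Finset.univ.filter fun I => G.IsIndepSet (I : Set V)

theorem mem_indepFamily {V : Type u} [Fintype V] (G : SimpleGraph V) (I : Finset V) :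
    I ∈ G.indepFamily ↔ G.IsIndepSet (I : Set V) := by
  simp [indepFamily]

open Classical in
/-- A fractional colouring assigns to each independent set `I` a number `f I ∈ [0,1]`, such that
the independent sets containing any given vertex have total weight at least `1`.
Only the values of `f` on independent sets matter, here and in the weight of `f`. -/
def IsFractionalColouring {V : Type u} [Fintype V] (G : SimpleGraph V)
    (f : Finset V → ℝ) : Prop :=
  (∀ I ∈ G.indepFamily, f I ∈ Set.Icc (0 : ℝ) 1) ∧
    ∀ x : V, 1 ≤ ∑ I ∈ G.indepFamily.filter (fun I => x ∈ I), f I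

/-- The weight of a fractional colouring. -/
noncomputable def fractionalWeight {V : Type u} [Fintype V] (G : SimpleGraph V)
    (f : Finset V → ℝ) : ℝ :=
  ∑ I ∈ G.indepFamily, f I

/-- The fractional chromatic number: the minimum weight of a fractional colouring.
The infimum is attained, see `isLeast_fractionalChromaticNumber`. -/
noncomputable def fractionalChromaticNumber {V : Type u} [Fintype V] (G : SimpleGraph V) : ℝ :=
  sInf {w : ℝ | ∃ f : Finset V → ℝ, G.IsFractionalColouring f ∧ G.fractionalWeight f = w}

open Classical in
/-- Every finite graph has a fractional colouring of minimum weight, and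
`fractionalChromaticNumber` is that minimum. -/
theorem isLeast_fractionalChromaticNumber {V : Type u} [Fintype V] (G : SimpleGraph V) :
    IsLeast {w : ℝ | ∃ f : Finset V → ℝ, G.IsFractionalColouring f ∧ G.fractionalWeight f = w}
      G.fractionalChromaticNumber := by
  let K : Set (Finset V → ℝ) :=
    {f | (∀ I, f I ∈ Set.Icc (0 : ℝ) 1) ∧
      ∀ x : V, 1 ≤ ∑ I ∈ G.indepFamily.filter (fun I => x ∈ I), f I}
  have hK : IsCompact K := by
    have h1 : IsCompact (Set.univ.pi fun _ : Finset V => Set.Icc (0 : ℝ) 1) :=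
      isCompact_univ_pi fun _ => isCompact_Icc
    have h2 : IsClosed {f : Finset V → ℝ |
        ∀ x : V, 1 ≤ ∑ I ∈ G.indepFamily.filter (fun I => x ∈ I), f I} := by
      simp only [Set.ofPred_forall]
      exact isClosed_iInter fun x => isClosed_le continuous_const (by fun_prop)
    have h3 : K = (Set.univ.pi fun _ : Finset V => Set.Icc (0 : ℝ) 1) ∩ {f : Finset V → ℝ |
        ∀ x : V, 1 ≤ ∑ I ∈ G.indepFamily.filter (fun I => x ∈ I), f I} := by
      ext f
      simp only [K, Set.mem_inter_iff, Set.mem_univ_pi, Set.mem_ofPred_eq]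
    rw [h3]
    exact h1.inter_right h2
  have hne : K.Nonempty := by
    refine ⟨fun _ => 1, fun _ => by simp, fun x => ?_⟩
    have hx : ({x} : Finset V) ∈ G.indepFamily.filter (fun I => x ∈ I) := by
      simp [mem_indepFamily]
    exact Finset.single_le_sum (f := fun _ : Finset V => (1 : ℝ)) (fun _ _ => zero_le_one) hx
  have hset : {w : ℝ | ∃ f : Finset V → ℝ, G.IsFractionalColouring f ∧ G.fractionalWeight f = w}
      = G.fractionalWeight '' K := by
    ext w
    constructor
    · rintro ⟨f, hf, rfl⟩
      refine ⟨fun I => if I ∈ G.indepFamily then f I else 0, ⟨fun I => ?_, fun x => ?_⟩, ?_⟩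
      · by_cases hI : I ∈ G.indepFamily
        · simpa [hI] using hf.1 I hI
        · simp [hI]
      · refine (hf.2 x).trans_eq (Finset.sum_congr rfl fun I hI => ?_)
        simp [(Finset.mem_filter.1 hI).1]
      · exact Finset.sum_congr rfl fun I hI => by simp [hI]
    · rintro ⟨f, hf, rfl⟩
      exact ⟨f, ⟨fun I _ => hf.1 I, hf.2⟩, rfl⟩
  have hc : IsCompact (G.fractionalWeight '' K) := by
    refine hK.image ?_
    unfold fractionalWeight
    fun_prop
  unfold fractionalChromaticNumber
  rw [hset]
  exact hc.isLeast_sInf (hne.image _)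

end Fractional

section Cone

/-- The `n`th cone `Δ_n(G)` over `G`: its vertices are the pairs `(x, i)` with `i = 0, …, n - 1`
(the `i`th layer), given as `some (x, i)`, and the apex `⋆`, given as `none`. -/
def cone {V : Type u} (G : SimpleGraph V) (n : ℕ) : SimpleGraph (Option (V × Fin n)) where
  Adj
    | some (x, i), some (y, j) => G.Adj x y ∧
        ((i : ℕ) + 1 = j ∨ (j : ℕ) + 1 = i ∨ ((i : ℕ) = 0 ∧ (j : ℕ) = 0))
    | some (_, i), none => (i : ℕ) + 1 = n
    | none, some (_, j) => (j : ℕ) + 1 = n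
    | none, none => False
  symm := ⟨by
    rintro (_ | ⟨x, i⟩) (_ | ⟨y, j⟩) h
    · exact h
    · exact h
    · exact h
    · exact ⟨h.1.symm, by tauto⟩⟩
  loopless := ⟨by
    rintro (_ | ⟨x, i⟩) h
    · exact h
    · exact G.loopless.irrefl x h.1⟩

/-- The vertices of the `(H, h)`-cone over `G` (with `V = V(G)` and `W = V(H)`), that is, of the
disjoint union of copies of `Δ_{h w}(G)`, one for each `w : W`, after the identification of the
vertices `((x, 0), w)`, `w : W`, to a single vertex `base x`, for each `x : V`. The other vertices
of the copy belonging to `w` are `inner w x i = ((x, i), w)`, `0 < i < h w`, and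
`apex w = (⋆, w)`. -/
inductive GenConeVertex (V : Type u) (W : Type v) (h : W → ℕ) : Type (max u v)
  | base (x : V) : GenConeVertex V W h
  | inner (w : W) (x : V) (i : Fin (h w)) (hi : 0 < (i : ℕ)) : GenConeVertex V W h
  | apex (w : W) : GenConeVertex V W h

namespace GenConeVertex

/-- The map from the copy of `Δ_{h w}(G)` that belongs to `w` to the `(H, h)`-cone over `G`. -/
def ofCopy {V : Type u} {W : Type v} {h : W → ℕ} (w : W) :
    Option (V × Fin (h w)) → GenConeVertex V W h
  | some (x, i) => if hi : 0 < (i : ℕ) then inner w x i hi else base x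
  | none => apex w

/-- The vertices of the `(H, h)`-cone as a sum of three types. -/
def equivSum (V : Type u) (W : Type v) (h : W → ℕ) :
    GenConeVertex V W h ≃ V ⊕ (Σ w : W, V × {i : Fin (h w) // 0 < (i : ℕ)}) ⊕ W where
  toFun
    | base x => Sum.inl x
    | inner w x i hi => Sum.inr (Sum.inl ⟨w, x, i, hi⟩)
    | apex w => Sum.inr (Sum.inr w)
  invFun
    | Sum.inl x => base x
    | Sum.inr (Sum.inl ⟨w, x, i, hi⟩) => inner w x i hi
    | Sum.inr (Sum.inr w) => apex w
  left_inv := by rintro (x | ⟨w, x, i, hi⟩ | w) <;> rfl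
  right_inv := by rintro (x | ⟨w, x, i, hi⟩ | w) <;> rfl

instance {V : Type u} {W : Type v} {h : W → ℕ} [Fintype V] [Fintype W] :
    Fintype (GenConeVertex V W h) :=
  Fintype.ofEquiv _ (equivSum V W h).symm

theorem ofCopy_injective {V : Type u} {W : Type v} {h : W → ℕ} (w : W) :
    Function.Injective (ofCopy (V := V) (h := h) w) := by
  rintro (_ | ⟨x, i⟩) (_ | ⟨y, j⟩) hxy
  · rfl
  · simp only [ofCopy] at hxy
    split_ifs at hxy
  · simp only [ofCopy] at hxy
    split_ifs at hxy
  · simp only [ofCopy] at hxy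
    split_ifs at hxy with h1 h2
    · simp only [inner.injEq] at hxy
      simp_all
    · simp only [base.injEq] at hxy
      have hij : i = j := Fin.ext (by omega)
      rw [hxy, hij]

end GenConeVertex

/-- The `(H, h)`-cone `Δ_{H,h}(G)` over `G`: its edges are those of the copies of the cones
`Δ_{h w}(G)`, `w ∈ V(H)`, and the edges `(⋆, w)(⋆, w')` for the edges `w w'` of `H`. -/
def genCone {V : Type u} {W : Type v} (G : SimpleGraph V) (H : SimpleGraph W) (h : W → ℕ) :
    SimpleGraph (GenConeVertex V W h) where
  Adj a b :=
    (∃ (w : W) (p q : Option (V × Fin (h w))), (G.cone (h w)).Adj p q ∧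
      GenConeVertex.ofCopy w p = a ∧ GenConeVertex.ofCopy w q = b) ∨
    (∃ w w' : W, H.Adj w w' ∧ GenConeVertex.apex w = a ∧ GenConeVertex.apex w' = b)
  symm := ⟨by
    rintro a b (⟨w, p, q, hpq, rfl, rfl⟩ | ⟨w, w', hw, rfl, rfl⟩)
    · exact Or.inl ⟨w, q, p, hpq.symm, rfl, rfl⟩
    · exact Or.inr ⟨w', w, hw.symm, rfl, rfl⟩⟩
  loopless := ⟨by
    rintro a (⟨w, p, q, hpq, hp, hq⟩ | ⟨w, w', hw, h1, h2⟩)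
    · obtain rfl := GenConeVertex.ofCopy_injective w (hp.trans hq.symm)
      exact hpq.ne rfl
    · have := h1.trans h2.symm
      simp only [GenConeVertex.apex.injEq] at this
      exact hw.ne this⟩

end Cone

end SimpleGraph

/-! Write a = χ_f(G), b = χ_f(H), q = a - 1 and S = 1 + q + … + q^(n-1). Both bounds are instances
of linear programming duality: a weighting of the vertices of the cone bounds its χ_f from below,
and a point of its stable set polytope with all coordinates at least r bounds it from above by 1/r.

Lower bound (`le_fractionalChromaticNumber_genCone`). Let g and h be fractional cliques of G and H
with totals a and t. In the copy of w, layer i > 0 gets h(w) q^(n-1-i) g and the apex h(w); the base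
gets (t q^(n-1) + 1 - t) g. The total is a(tS + 1 - t) + t. An independent set cuts each copy into
sets A_i with no edges between consecutive ones. An averaging inequality for three consecutive sets
(`mul_setWeight_add_le`) bounds Σ q^(n-1-i) g(A_i) by S; it is at most S - 1 if the apex is used,
and, for odd n and a ≥ 2, at most S - 1 + g(A_0) in any case. Hence independent sets weigh at most
tS + 1 - t, with t = 1 for even n and t = b for odd n. The case a = 1 forces b = 1.

Upper bound (`fractionalChromaticNumber_genCone_le`). A set of type j repeats a random independent
set of G in layers 0, …, j, then alternates empty and full layers. With weights a q^j, an adjusted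
last type and one extra set of all odd layers, all layers are covered equally. Apices come from a
random independent set Q of H: copies in Q get the types that leave the last layer empty, the other
copies the remaining types. This needs the former types to have share at most 1/b, which is where b
≤ a enters. -/

namespace SimpleGraph

/-! ### The stable set polytope and linear programming duality -/

section StablePolytope

variable {V : Type u} {G : SimpleGraph V}

/-- The stable set polytope: the convex hull of the indicator functions of independent sets. -/
def stablePolytope (G : SimpleGraph V) : Set (V → ℝ) :=
  convexHull ℝ {u | ∃ I : Set V, G.IsIndepSet I ∧ u = I.indicator 1}

theorem convex_stablePolytope : Convex ℝ G.stablePolytope :=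
  convex_convexHull ℝ _

theorem indicator_mem_stablePolytope {I : Set V} (hI : G.IsIndepSet I) :
    I.indicator 1 ∈ G.stablePolytope :=
  subset_convexHull ℝ _ ⟨I, hI, rfl⟩

theorem stablePolytope_subset {s : Set (V → ℝ)} (hs : Convex ℝ s)
    (h : ∀ I : Set V, G.IsIndepSet I → I.indicator 1 ∈ s) : G.stablePolytope ⊆ s := by
  refine convexHull_min ?_ hs
  rintro _ ⟨I, hI, rfl⟩
  exact h I hI

/-- Preimages of convex sets under affine maps are convex, so indicators suffice. This is how random
independent sets of `G` and `H` are carried to the cone. -/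
theorem map_mem_of_mem_stablePolytope {V' : Type*} {T : Set (V' → ℝ)} (hT : Convex ℝ T)
    (Φ : (V → ℝ) → V' → ℝ)
    (hΦ : ∀ (u v : V → ℝ) (s t : ℝ), s + t = 1 → Φ (s • u + t • v) = s • Φ u + t • Φ v)
    (h : ∀ I : Set V, G.IsIndepSet I → Φ (I.indicator 1) ∈ T)
    {u : V → ℝ} (hu : u ∈ G.stablePolytope) : Φ u ∈ T := by
  have hc : Convex ℝ {u | Φ u ∈ T} := by
    intro u hu v hv s t hs ht hst
    change Φ _ ∈ T
    rw [hΦ _ _ _ _ hst]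
    exact hT hu hv hs ht hst
  exact stablePolytope_subset hc h hu

theorem sum_mul_le_of_mem_stablePolytope [Fintype V] {c : V → ℝ} {M : ℝ}
    (h : ∀ I : Set V, G.IsIndepSet I → ∑ x, c x * I.indicator 1 x ≤ M)
    {u : V → ℝ} (hu : u ∈ G.stablePolytope) : ∑ x, c x * u x ≤ M := by
  have hc : Convex ℝ {u : V → ℝ | ∑ x, c x * u x ≤ M} := by
    intro u hu v hv s t hs ht hst
    have h1 : ∑ x, c x * (s • u + t • v) x = s * ∑ x, c x * u x + t * ∑ x, c x * v x := by
      simp only [Finset.mul_sum, ← Finset.sum_add_distrib]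
      refine Finset.sum_congr rfl fun x _ => ?_
      simp only [Pi.add_apply, Pi.smul_apply, smul_eq_mul]
      ring
    change ∑ x, c x * (s • u + t • v) x ≤ M
    rw [h1]
    calc _ ≤ s * M + t * M :=
          add_le_add (mul_le_mul_of_nonneg_left hu hs) (mul_le_mul_of_nonneg_left hv ht)
      _ = M := by rw [← add_mul, hst, one_mul]
  exact stablePolytope_subset hc h hu

theorem IsIndepSet.subset_of {I J : Set V} (hJ : G.IsIndepSet J) (h : I ⊆ J) :
    G.IsIndepSet I :=
  Set.Pairwise.mono h hJ

/-- Deleting `x` from every independent set makes the coordinate `0`; interpolation gives the values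
in between. -/
theorem update_mem_stablePolytope [DecidableEq V] {u : V → ℝ} (hu : u ∈ G.stablePolytope)
    (x : V) {r : ℝ} (h0 : 0 ≤ r) (hr : r ≤ u x) :
    Function.update u x r ∈ G.stablePolytope := by
  have hz : Function.update u x 0 ∈ G.stablePolytope := by
    refine map_mem_of_mem_stablePolytope convex_stablePolytope
      (fun u => Function.update u x 0) (fun u v s t _ => ?_) (fun I hI => ?_) hu
    · ext y
      by_cases hy : y = x
      · subst hy; simp
      · simp [hy]
    · have : Function.update (I.indicator (1 : V → ℝ)) x 0 = (I \ {x}).indicator 1 := by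
        ext y
        by_cases hy : y = x
        · subst hy; simp
        · by_cases hyI : y ∈ I <;> simp [hy, hyI, Set.indicator]
      change Function.update (I.indicator (1 : V → ℝ)) x 0 ∈ _
      rw [this]
      exact indicator_mem_stablePolytope (hI.subset_of Set.sdiff_subset)
  rcases (h0.trans hr).eq_or_lt with h | h
  · have : r = 0 := le_antisymm (h ▸ hr) h0
    rwa [this]
  · have := convex_stablePolytope hu hz (a := r / u x) (b := 1 - r / u x) (by positivity)
      (sub_nonneg.2 ((div_le_one h).2 hr)) (by ring)
    convert this using 1
    ext y
    by_cases hy : y = x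
    · subst hy
      simp [h.ne']
    · simp [hy]
      ring

theorem mem_stablePolytope_of_le [Fintype V] {u v : V → ℝ} (hu : u ∈ G.stablePolytope)
    (h0 : 0 ≤ v) (hv : v ≤ u) : v ∈ G.stablePolytope := by
  classical
  have key : ∀ s : Finset V, (fun x => if x ∈ s then v x else u x) ∈ G.stablePolytope := by
    intro s
    induction s using Finset.induction_on with
    | empty => simpa using hu
    | insert x s hx ih =>
      convert update_mem_stablePolytope ih x (h0 x) (by simpa [hx] using hv x) using 1
      ext y
      by_cases hy : y = x
      · subst hy; simp
      · simp [hy]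
  simpa using key Finset.univ

open Classical in
theorem exists_weights_of_mem_stablePolytope [Fintype V] {u : V → ℝ}
    (hu : u ∈ G.stablePolytope) :
    ∃ F : Finset V → ℝ, (∀ I, 0 ≤ F I) ∧ ∑ I ∈ G.indepFamily, F I = 1 ∧
      ∀ x, ∑ I ∈ G.indepFamily.filter (fun I => x ∈ I), F I = u x := by
  let Q : Set (V → ℝ) := {u | ∃ F : Finset V → ℝ, (∀ I, 0 ≤ F I) ∧
    ∑ I ∈ G.indepFamily, F I = 1 ∧
      ∀ x, ∑ I ∈ G.indepFamily.filter (fun I => x ∈ I), F I = u x}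
  have hQ : Convex ℝ Q := by
    rintro u ⟨F, hF, hF1, hFu⟩ v ⟨F', hF', hF1', hFv⟩ s t hs ht hst
    refine ⟨fun I => s * F I + t * F' I, fun I => ?_, ?_, fun x => ?_⟩
    · exact add_nonneg (mul_nonneg hs (hF I)) (mul_nonneg ht (hF' I))
    · rw [Finset.sum_add_distrib, ← Finset.mul_sum, ← Finset.mul_sum, hF1, hF1']
      simpa using hst
    · rw [Finset.sum_add_distrib, ← Finset.mul_sum, ← Finset.mul_sum, hFu, hFv]
      simp
  refine stablePolytope_subset hQ (fun I hI => ?_) hu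
  have hmem : I.toFinset ∈ G.indepFamily := by simpa [mem_indepFamily] using hI
  refine ⟨fun J => if J = I.toFinset then 1 else 0, fun J => by positivity, ?_, fun x => ?_⟩
  · simp [hmem]
  · simp [hmem, Set.indicator]

theorem fractionalChromaticNumber_le_of_mem_stablePolytope [Fintype V] {u : V → ℝ}
    (hu : u ∈ G.stablePolytope) {ρ : ℝ} (hρ : 0 < ρ) (h : ∀ x, ρ ≤ u x) :
    G.fractionalChromaticNumber ≤ 1 / ρ := by
  classical
  obtain ⟨F, hF, hF1, hFu⟩ := exists_weights_of_mem_stablePolytope hu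
  -- Colourings take values at most `1`, hence the truncation; a set that reaches `1` covers its
  -- vertices alone.
  let f : Finset V → ℝ := fun I => min 1 (F I / ρ)
  have hf0 : ∀ I, 0 ≤ f I := fun I => le_min zero_le_one (div_nonneg (hF I) hρ.le)
  have hf : G.IsFractionalColouring f := by
    refine ⟨fun I _ => ⟨hf0 I, min_le_left _ _⟩, fun x => ?_⟩
    by_cases hx : ∃ I ∈ G.indepFamily.filter (fun I => x ∈ I), 1 ≤ F I / ρ
    · obtain ⟨I, hI, h1⟩ := hx
      calc (1 : ℝ) = f I := (min_eq_left h1).symm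
        _ ≤ _ := by
          convert Finset.single_le_sum (fun J _ => hf0 J) hI
    · push Not at hx
      have h2 : ∑ I ∈ G.indepFamily.filter (fun I => x ∈ I), f I = u x / ρ := by
        rw [← hFu, Finset.sum_div]
        exact Finset.sum_congr rfl fun I hI => min_eq_right (hx I hI).le
      have h3 : 1 ≤ u x / ρ := (one_le_div hρ).2 (h x)
      rw [← h2] at h3
      convert h3
  calc G.fractionalChromaticNumber ≤ G.fractionalWeight f :=
        G.isLeast_fractionalChromaticNumber.2 ⟨f, hf, rfl⟩
    _ ≤ ∑ I ∈ G.indepFamily, F I / ρ := Finset.sum_le_sum fun I _ => min_le_right _ _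
    _ = 1 / ρ := by rw [← Finset.sum_div, hF1]

theorem one_le_fractionalChromaticNumber [Fintype V] [Nonempty V] :
    1 ≤ G.fractionalChromaticNumber := by
  classical
  obtain ⟨f, hf, hw⟩ := G.isLeast_fractionalChromaticNumber.1
  obtain ⟨x⟩ := ‹Nonempty V›
  rw [← hw]
  refine (hf.2 x).trans ?_
  exact Finset.sum_le_sum_of_subset_of_nonneg (Finset.filter_subset _ _)
    fun I hI _ => (hf.1 I hI).1

theorem nonempty_of_fractionalChromaticNumber_pos [Fintype V]
    (h : 0 < G.fractionalChromaticNumber) : Nonempty V := by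
  by_contra hV
  rw [not_nonempty_iff] at hV
  have : G.fractionalChromaticNumber ≤ 0 :=
    G.isLeast_fractionalChromaticNumber.2
      ⟨fun _ => 0, ⟨fun I _ => by simp, fun x => hV.elim x⟩, by simp [fractionalWeight]⟩
  exact absurd h this.not_gt

theorem const_mem_stablePolytope [Fintype V] [Nonempty V] :
    (fun _ => 1 / G.fractionalChromaticNumber) ∈ G.stablePolytope := by
  classical
  obtain ⟨f, hf, hw⟩ := G.isLeast_fractionalChromaticNumber.1
  set a := G.fractionalChromaticNumber
  have ha : 0 < a := zero_lt_one.trans_le one_le_fractionalChromaticNumber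
  have hmem : ∑ I ∈ G.indepFamily, (f I / a) • (I : Set V).indicator (1 : V → ℝ) ∈
      G.stablePolytope := by
    refine convex_stablePolytope.sum_mem (fun I hI => div_nonneg (hf.1 I hI).1 ha.le) ?_
      (fun I hI => indicator_mem_stablePolytope ((mem_indepFamily G I).1 hI))
    rw [← Finset.sum_div]
    exact (div_eq_one_iff_eq ha.ne').2 hw
  refine mem_stablePolytope_of_le hmem (fun x => by positivity) fun x => ?_
  have h1 : (∑ I ∈ G.indepFamily, (f I / a) • (I : Set V).indicator (1 : V → ℝ)) x =
      (∑ I ∈ G.indepFamily.filter (fun I => x ∈ I), f I) / a := by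
    rw [Finset.sum_apply, Finset.sum_div, Finset.sum_filter]
    exact Finset.sum_congr rfl fun I _ => by simp [Set.indicator]
  rw [h1]
  gcongr
  convert hf.2 x

theorem const_mem_stablePolytope_of_le [Fintype V] [Nonempty V] {r : ℝ} (h0 : 0 ≤ r)
    (h : r ≤ 1 / G.fractionalChromaticNumber) : (fun _ => r) ∈ G.stablePolytope :=
  mem_stablePolytope_of_le const_mem_stablePolytope (fun _ => h0) (fun _ => h)

/-- The ends of an edge form a clique of weight `2`; without edges the whole vertex set is
independent. -/
theorem fractionalChromaticNumber_eq_one_or_two_le [Fintype V] [Nonempty V] :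
    G.fractionalChromaticNumber = 1 ∨ 2 ≤ G.fractionalChromaticNumber := by
  classical
  have ha := one_le_fractionalChromaticNumber (G := G)
  by_cases h : ∃ x y, G.Adj x y
  · right
    obtain ⟨x, y, hxy⟩ := h
    have := sum_mul_le_of_mem_stablePolytope (G := G) (M := 1)
      (c := fun z => (if z = x then 1 else 0) + (if z = y then 1 else 0)) (fun I hI => ?_)
      const_mem_stablePolytope
    · simp only [add_mul, Finset.sum_add_distrib, ite_mul, one_mul, zero_mul,
        Finset.sum_ite_eq', Finset.mem_univ, if_true] at this
      rw [← add_div, div_le_one (by linarith)] at this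
      linarith
    · simp only [add_mul, Finset.sum_add_distrib, ite_mul, one_mul, zero_mul,
        Finset.sum_ite_eq', Finset.mem_univ, if_true]
      by_cases hx : x ∈ I
      · have hy : y ∉ I := fun hy => hI hx hy hxy.ne hxy
        simp [hx, hy]
      · by_cases hy : y ∈ I <;> simp [hx, hy]
  · left
    push Not at h
    refine le_antisymm ?_ ha
    have hI : G.IsIndepSet Set.univ := fun x _ y _ _ => h x y
    simpa using fractionalChromaticNumber_le_of_mem_stablePolytope
      (indicator_mem_stablePolytope hI) one_pos (fun x => by simp)

/-- Weak linear programming duality. -/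
theorem sum_le_mul_fractionalChromaticNumber [Fintype V] [Nonempty V] {c : V → ℝ} {M : ℝ}
    (h : ∀ I : Set V, G.IsIndepSet I → ∑ x, c x * I.indicator 1 x ≤ M) :
    ∑ x, c x ≤ M * G.fractionalChromaticNumber := by
  have ha : 0 < G.fractionalChromaticNumber :=
    zero_lt_one.trans_le one_le_fractionalChromaticNumber
  have := sum_mul_le_of_mem_stablePolytope h const_mem_stablePolytope
  rw [← Finset.sum_mul, mul_one_div, div_le_iff₀ ha] at this
  exact this

/-- A fractional clique: a weighting of the vertices under which every independent set has
weight at most `1`. -/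
structure IsFractionalClique [Fintype V] (G : SimpleGraph V) (g : V → ℝ) : Prop where
  nonneg : ∀ x, 0 ≤ g x
  sum_indicator_le : ∀ I : Set V, G.IsIndepSet I → ∑ x, g x * I.indicator 1 x ≤ 1

/-- Strong linear programming duality for fractional colourings. -/
theorem exists_isFractionalClique [Fintype V] [Nonempty V] (G : SimpleGraph V) :
    ∃ g : V → ℝ, G.IsFractionalClique g ∧ ∑ x, g x = G.fractionalChromaticNumber := by
  classical
  set a := G.fractionalChromaticNumber with ha_def
  have ha : 0 < a := zero_lt_one.trans_le one_le_fractionalChromaticNumber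
  -- A point of the polytope in this open box would give a colouring of weight below `a`. The clique
  -- is a multiple of minus the separating functional.
  let U : Set (V → ℝ) := Set.univ.pi fun _ => Set.Ioi (1 / a)
  have hU : IsOpen U := isOpen_set_pi Set.finite_univ fun _ _ => isOpen_Ioi
  have hUc : Convex ℝ U := convex_pi fun _ _ => convex_Ioi _
  have hd : Disjoint U G.stablePolytope := by
    rw [Set.disjoint_left]
    intro u hu hP
    obtain ⟨x₀, hx₀⟩ := Finite.exists_min u
    have h1 : 1 / a < u x₀ := hu x₀ trivial
    have hpos : 0 < u x₀ := lt_trans (by positivity) h1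
    have h2 := fractionalChromaticNumber_le_of_mem_stablePolytope hP hpos hx₀
    have h3 : 1 / u x₀ < a := (one_div_lt ha hpos).1 h1
    exact absurd h2 h3.not_ge
  obtain ⟨φ, s, hφU, hφP⟩ := geometric_hahn_banach_open hUc hU convex_stablePolytope hd
  let g : V → ℝ := fun x => -φ (Pi.single x 1)
  have hg : ∀ u : V → ℝ, φ u = -∑ x, g x * u x := by
    intro u
    conv_lhs => rw [← Finset.univ_sum_single u]
    rw [map_sum, ← Finset.sum_neg_distrib]
    refine Finset.sum_congr rfl fun x _ => ?_
    have : (Pi.single x (u x) : V → ℝ) = u x • Pi.single x (1 : ℝ) := by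
      rw [← Pi.single_smul, smul_eq_mul, mul_one]
    rw [this, map_smul, smul_eq_mul]
    simp only [g]
    ring
  have hU' : ∀ u : V → ℝ, (∀ x, 1 / a < u x) → -s < ∑ x, g x * u x := by
    intro u hu
    have := hφU u fun x _ => hu x
    rw [hg] at this
    linarith
  have hs : 0 ≤ -s := by
    have h0 : (0 : V → ℝ) ∈ G.stablePolytope := by
      have := indicator_mem_stablePolytope (G := G) (I := ∅) (by simp [IsIndepSet])
      rwa [Set.indicator_empty'] at this
    have := hφP 0 h0
    rw [map_zero] at this
    linarith
  have hg0 : ∀ x, 0 ≤ g x := by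
    intro x
    by_contra! hx
    -- Raising the coordinate `x` by `|B| / -g x` brings the sum down to `B - |B| ≤ 0 ≤ -s`.
    set B := ∑ y, g y * (1 / a + 1)
    have h1 := hU' (fun y => 1 / a + 1 + if y = x then (|B| / -g x) else 0) fun y => by
      have : 0 ≤ |B| / -g x := div_nonneg (abs_nonneg _) (by linarith)
      split_ifs <;> linarith
    simp only [mul_add (g _) (1 / a + 1), Finset.sum_add_distrib, mul_ite, mul_zero,
      Finset.sum_ite_eq', Finset.mem_univ, if_true] at h1
    have h2 : g x * (|B| / -g x) = -|B| := by
      rw [div_neg, mul_neg, mul_div_cancel₀ _ hx.ne]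
    have := le_abs_self B
    change -s < B + _ at h1
    linarith
  have hlim : -s ≤ (∑ x, g x) / a := by
    refine le_of_forall_pos_lt_add fun ε hε => ?_
    have hG : 0 ≤ ∑ x, g x := Finset.sum_nonneg fun x _ => hg0 x
    have h1 := hU' (fun _ => 1 / a + ε / (∑ x, g x + 1)) fun x => by
      have : 0 < ε / (∑ x, g x + 1) := by positivity
      linarith
    rw [← Finset.sum_mul, mul_add, mul_one_div] at h1
    have h2 : (∑ x, g x) * (ε / (∑ x, g x + 1)) ≤ ε := by
      rw [mul_div_assoc', div_le_iff₀ (by positivity)]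
      nlinarith
    linarith
  have hGpos : 0 < ∑ x, g x := by
    have h1 := hU' (fun _ => 1 / a + 1) fun x => by linarith
    rw [← Finset.sum_mul] at h1
    have h2 : 0 < 1 / a + 1 := by positivity
    exact pos_of_mul_pos_left (hs.trans_lt h1) h2.le
  refine ⟨fun x => g x * (a / ∑ x, g x), ⟨fun x => mul_nonneg (hg0 x) (by positivity),
    fun I hI => ?_⟩, ?_⟩
  · have h1 := hφP _ (indicator_mem_stablePolytope hI)
    rw [hg] at h1
    have h2 : ∑ x, g x * (a / ∑ x, g x) * I.indicator 1 x =
        (∑ x, g x * I.indicator 1 x) * (a / ∑ x, g x) := by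
      rw [Finset.sum_mul]
      exact Finset.sum_congr rfl fun x _ => by ring
    rw [h2]
    calc _ ≤ (∑ x, g x) / a * (a / ∑ x, g x) := by
          gcongr
          linarith
      _ = 1 := by field_simp
  · rw [← Finset.sum_mul]
    field_simp

end StablePolytope

/-! ### Weights of sequences of layers -/

section Chains

variable {V : Type u} {G : SimpleGraph V}

/-- There are no edges between `A` and `B`. -/
def NoEdgesBetween (G : SimpleGraph V) (A B : Set V) : Prop :=
  ∀ x ∈ A, ∀ y ∈ B, ¬ G.Adj x y

theorem noEdgesBetween_self_iff {A : Set V} : G.NoEdgesBetween A A ↔ G.IsIndepSet A :=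
  ⟨fun h _ hx _ hy _ => h _ hx _ hy, fun h x hx y hy hxy => h hx hy hxy.ne hxy⟩

/-- The weight of a set of vertices. -/
noncomputable def setWeight [Fintype V] (g : V → ℝ) (A : Set V) : ℝ :=
  ∑ x, g x * A.indicator 1 x

theorem setWeight_mono [Fintype V] {g : V → ℝ} (hg : ∀ x, 0 ≤ g x) {A B : Set V} (h : A ⊆ B) :
    setWeight g A ≤ setWeight g B := by
  refine Finset.sum_le_sum fun x _ => mul_le_mul_of_nonneg_left ?_ (hg x)
  exact Set.indicator_le_indicator_of_subset h (fun _ => zero_le_one) x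

theorem setWeight_nonneg [Fintype V] {g : V → ℝ} (hg : ∀ x, 0 ≤ g x) (A : Set V) :
    0 ≤ setWeight g A :=
  Finset.sum_nonneg fun x _ => mul_nonneg (hg x) (Set.indicator_nonneg (fun _ _ => zero_le_one) x)

@[simp] theorem setWeight_empty [Fintype V] (g : V → ℝ) : setWeight g ∅ = 0 := by
  simp [setWeight]

theorem setWeight_inter_add_diff [Fintype V] (g : V → ℝ) (A B : Set V) :
    setWeight g (A ∩ B) + setWeight g (A \ B) = setWeight g A := by
  classical
  simp only [setWeight, ← Finset.sum_add_distrib]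
  refine Finset.sum_congr rfl fun x _ => ?_
  by_cases hA : x ∈ A <;> by_cases hB : x ∈ B <;> simp [Set.indicator, hA, hB]

theorem IsFractionalClique.setWeight_le_one [Fintype V] {g : V → ℝ} (hg : G.IsFractionalClique g)
    {I : Set V} (hI : G.IsIndepSet I) : setWeight g I ≤ 1 :=
  hg.sum_indicator_le I hI

/-- With `D` and `E` as in the proof, no edge joins `D` to `D ∪ E`, so `D ∪ (J ∩ E)` is independent
for every independent `J`. Averaging its weight bound over an optimal fractional colouring, which
gives each vertex share `1 / a`, yields the claim. -/
theorem IsFractionalClique.mul_setWeight_add_le [Fintype V] [Nonempty V] {g : V → ℝ}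
    (hg : G.IsFractionalClique g) {A B C : Set V} (hAB : G.NoEdgesBetween A B)
    (hBC : G.NoEdgesBetween B C) :
    G.fractionalChromaticNumber * setWeight g (B ∩ (A ∪ C)) + setWeight g (C \ B) +
      setWeight g (B \ (A ∪ C)) ≤ G.fractionalChromaticNumber := by
  classical
  have ha : 0 < G.fractionalChromaticNumber :=
    zero_lt_one.trans_le one_le_fractionalChromaticNumber
  set D := B ∩ (A ∪ C)
  set E := (C \ B) ∪ (B \ (A ∪ C)) with hE
  have hBA : ∀ x ∈ B, ∀ y ∈ A, ¬ G.Adj x y := fun x hx y hy h => hAB y hy x hx h.symm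
  have hCB : ∀ x ∈ C, ∀ y ∈ B, ¬ G.Adj x y := fun x hx y hy h => hBC y hy x hx h.symm
  have hDE : ∀ x ∈ D, ∀ y ∈ E, ¬ G.Adj x y := by
    rintro x ⟨hxB, hx⟩ y (⟨hyC, -⟩ | ⟨hyB, -⟩)
    · exact hBC x hxB y hyC
    · rcases hx with hx | hx
      · exact hAB x hx y hyB
      · exact hCB x hx y hyB
  have hind : ∀ J : Set V, G.IsIndepSet J → G.IsIndepSet (D ∪ J ∩ E) := by
    rintro J hJ x (hx | ⟨hxJ, hxE⟩) y (hy | ⟨hyJ, hyE⟩) hne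
    · rcases hy.2 with hyA | hyC
      · exact hBA x hx.1 y hyA
      · exact hBC x hx.1 y hyC
    · exact hDE x hx y hyE
    · exact fun h => hDE y hy x hxE h.symm
    · exact hJ hxJ hyJ hne
  have key := sum_mul_le_of_mem_stablePolytope (G := G) (M := 1 - setWeight g D)
    (c := fun x => g x * E.indicator 1 x) (fun J hJ => ?_) const_mem_stablePolytope
  · rw [← Finset.sum_mul, mul_one_div, div_le_iff₀ ha] at key
    have h1 : ∑ x, g x * E.indicator 1 x = setWeight g (C \ B) + setWeight g (B \ (A ∪ C)) := by
      simp only [setWeight, ← Finset.sum_add_distrib]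
      refine Finset.sum_congr rfl fun x _ => ?_
      by_cases hA : x ∈ A <;> by_cases hB : x ∈ B <;> by_cases hC : x ∈ C <;>
        simp [hE, Set.indicator, hA, hB, hC]
    rw [h1] at key
    linarith
  · have h2 : setWeight g (D ∪ J ∩ E) =
        setWeight g D + ∑ x, g x * E.indicator 1 x * J.indicator 1 x := by
      simp only [setWeight, ← Finset.sum_add_distrib]
      refine Finset.sum_congr rfl fun x _ => ?_
      by_cases hA : x ∈ A <;> by_cases hB : x ∈ B <;> by_cases hC : x ∈ C <;>
        by_cases hJ : x ∈ J <;> simp [hE, D, Set.indicator, hA, hB, hC, hJ]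
    have h3 := hg.setWeight_le_one (hind J hJ)
    linarith

/-- The weight of the first `m` members of a sequence of sets, where the weights of consecutive
members are scaled by consecutive powers of `q`, the last one by `1`. -/
noncomputable def chainWeight [Fintype V] (g : V → ℝ) (q : ℝ) (A : ℕ → Set V) : ℕ → ℝ
  | 0 => 0
  | m + 1 => q * chainWeight g q A m + setWeight g (A m)

theorem chainWeight_succ_eq_sum [Fintype V] (g : V → ℝ) (q : ℝ) (A : ℕ → Set V) (m : ℕ) :
    chainWeight g q A (m + 1) =
      q ^ m * setWeight g (A 0) + ∑ j ∈ Finset.range m, q ^ (m - 1 - j) * setWeight g (A (j + 1)) := by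
  induction m with
  | zero => simp [chainWeight]
  | succ m ih =>
    rw [chainWeight, ih, Finset.sum_range_succ, mul_add, Finset.mul_sum]
    have : ∀ j ∈ Finset.range m, q * (q ^ (m - 1 - j) * setWeight g (A (j + 1))) =
        q ^ (m + 1 - 1 - j) * setWeight g (A (j + 1)) := by
      intro j hj
      rw [Finset.mem_range] at hj
      rw [← mul_assoc, ← pow_succ']
      congr 2
      omega
    rw [Finset.sum_congr rfl this]
    simp
    ring

/-- A sequence of sets as it is cut out of the layers of a cone by an independent set. -/
structure IsChain (G : SimpleGraph V) (A : ℕ → Set V) : Prop where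
  zero : G.NoEdgesBetween (A 0) (A 0)
  succ : ∀ i, G.NoEdgesBetween (A i) (A (i + 1))

theorem IsChain.pred {A : ℕ → Set V} (hA : G.IsChain A) (m : ℕ) :
    G.NoEdgesBetween (A (m - 1)) (A m) := by
  cases m with
  | zero => exact hA.zero
  | succ m => exact hA.succ m

variable [Fintype V] [Nonempty V] {g : V → ℝ} {A : ℕ → Set V}

/-- The extra term makes the induction close: the part of `A m` outside both neighbours has
coefficient `a = q + 1`, of which `q` is paid by the induction hypothesis and `1` by the three-set
inequality. For `m = 0` the truncated predecessor is `A 0` itself. -/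
theorem IsChain.mul_chainWeight_add_le (hA : G.IsChain A) (hg : G.IsFractionalClique g) (m : ℕ) :
    G.fractionalChromaticNumber * chainWeight g (G.fractionalChromaticNumber - 1) A m +
        setWeight g (A m \ A (m - 1)) ≤
      G.fractionalChromaticNumber *
        ∑ k ∈ Finset.range m, (G.fractionalChromaticNumber - 1) ^ k := by
  have ha : 1 ≤ G.fractionalChromaticNumber := one_le_fractionalChromaticNumber
  induction m with
  | zero => simp [chainWeight]
  | succ m ih =>
    have h1 := hg.mul_setWeight_add_le (hA.pred m) (hA.succ m)
    have h2 := setWeight_inter_add_diff g (A m) (A (m - 1) ∪ A (m + 1))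
    have h3 : setWeight g (A m \ (A (m - 1) ∪ A (m + 1))) ≤ setWeight g (A m \ A (m - 1)) :=
      setWeight_mono hg.nonneg (Set.sdiff_subset_sdiff_right Set.subset_union_left)
    rw [geom_sum_succ, chainWeight, Nat.add_sub_cancel]
    set a := G.fractionalChromaticNumber
    rw [← h2]
    have h4 := mul_le_mul_of_nonneg_left ih (sub_nonneg.2 ha)
    have h5 := mul_le_mul_of_nonneg_left h3 (sub_nonneg.2 ha)
    linarith

theorem IsChain.chainWeight_le (hA : G.IsChain A) (hg : G.IsFractionalClique g) (m : ℕ) :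
    chainWeight g (G.fractionalChromaticNumber - 1) A m ≤
      ∑ k ∈ Finset.range m, (G.fractionalChromaticNumber - 1) ^ k := by
  have ha : 1 ≤ G.fractionalChromaticNumber := one_le_fractionalChromaticNumber
  have h1 := hA.mul_chainWeight_add_le hg m
  have h2 := setWeight_nonneg hg.nonneg (A m \ A (m - 1))
  exact le_of_mul_le_mul_left (by linarith) (zero_lt_one.trans_le ha)

/-- An empty last layer leaves room for an apex of weight `1`. -/
theorem IsChain.chainWeight_succ_add_one_le (hA : G.IsChain A) (hg : G.IsFractionalClique g)
    (m : ℕ) (hm : A m = ∅) :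
    chainWeight g (G.fractionalChromaticNumber - 1) A (m + 1) + 1 ≤
      ∑ k ∈ Finset.range (m + 1), (G.fractionalChromaticNumber - 1) ^ k := by
  have ha : 1 ≤ G.fractionalChromaticNumber := one_le_fractionalChromaticNumber
  have h1 := mul_le_mul_of_nonneg_left (hA.chainWeight_le hg m) (sub_nonneg.2 ha)
  rw [geom_sum_succ, chainWeight, hm, setWeight_empty]
  linarith

theorem IsChain.chainWeight_odd_le (hA : G.IsChain A) (hg : G.IsFractionalClique g)
    (ha : 2 ≤ G.fractionalChromaticNumber) (k : ℕ) :
    chainWeight g (G.fractionalChromaticNumber - 1) A (2 * k + 1) ≤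
      ∑ k ∈ Finset.range (2 * k + 1), (G.fractionalChromaticNumber - 1) ^ k - 1 +
        setWeight g (A 0) := by
  induction k with
  | zero => simp [chainWeight]
  | succ k ih =>
    obtain ⟨m, hm⟩ : ∃ m, 2 * k + 1 = m := ⟨_, rfl⟩
    rw [show 2 * (k + 1) + 1 = m + 1 + 1 by omega]
    rw [hm] at ih
    have h0 := hA.mul_chainWeight_add_le hg m
    have h1 := hg.mul_setWeight_add_le (hA.pred m) (hA.succ m)
    have h2 := setWeight_inter_add_diff g (A m) (A (m - 1) ∪ A (m + 1))
    have h3 : setWeight g (A m \ (A (m - 1) ∪ A (m + 1))) ≤ setWeight g (A m \ A (m - 1)) :=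
      setWeight_mono hg.nonneg (Set.sdiff_subset_sdiff_right Set.subset_union_left)
    have h4 := setWeight_inter_add_diff g (A (m + 1)) (A m)
    have h5 : setWeight g (A (m + 1) ∩ A m) ≤ setWeight g (A m ∩ (A (m - 1) ∪ A (m + 1))) :=
      setWeight_mono hg.nonneg fun x hx => ⟨hx.2, Or.inr hx.1⟩
    rw [geom_sum_succ, geom_sum_succ, chainWeight, chainWeight]
    set a := G.fractionalChromaticNumber
    -- Since `(a - 1) ^ 2 = a * (a - 2) + 1`, `h0` is used with factor `a - 2` and `ih` once; the
    -- remaining terms are bounded by `h1`.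
    have h6 := mul_le_mul_of_nonneg_left h0 (sub_nonneg.2 ha)
    have h7 := mul_le_mul_of_nonneg_left h3 (sub_nonneg.2 ha)
    rw [← h2]
    linarith

end Chains

/-! ### Functions and sets on the cone, layer by layer -/

namespace GenConeVertex

variable {V : Type u} {W : Type v} {n : ℕ}

/-- The function on the vertices of the `(H, n)`-cone with given values on the base, on the inner
layers and on the apices. -/
def coneFun (α : V → ℝ) (l : W → V → ℕ → ℝ) (μ : W → ℝ) : GenConeVertex V W (fun _ => n) → ℝ
  | base x => α x
  | inner w x i _ => l w x i
  | apex w => μ w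

/-- The set of vertices of the `(H, n)`-cone with given slices. -/
def coneSet (B : Set V) (L : W → ℕ → Set V) (Q : Set W) : Set (GenConeVertex V W (fun _ => n)) :=
  {p | match p with
    | base x => x ∈ B
    | inner w x i _ => x ∈ L w i
    | apex w => w ∈ Q}

theorem indicator_coneSet (B : Set V) (L : W → ℕ → Set V) (Q : Set W) :
    (coneSet (n := n) B L Q).indicator (1 : GenConeVertex V W (fun _ => n) → ℝ) =
      coneFun (B.indicator 1) (fun w x i => (L w i).indicator 1 x) (Q.indicator 1) := by
  classical
  ext (x | ⟨w, x, i, hi⟩ | w) <;> rfl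

theorem ofCopy_some_mem_coneSet {B : Set V} {L : W → ℕ → Set V} {Q : Set W}
    (hL : ∀ w, L w 0 = B) (w : W) (x : V) (i : Fin n) :
    ofCopy (h := fun _ => n) w (some (x, i)) ∈ coneSet B L Q ↔ x ∈ L w i := by
  by_cases hi : 0 < (i : ℕ)
  · simp [ofCopy, hi, coneSet]
  · have : (i : ℕ) = 0 := by omega
    simp [ofCopy, this, coneSet, hL]

theorem sum_coneFun [Fintype V] [Fintype W] {N : ℕ} (α : V → ℝ) (l : W → V → ℕ → ℝ)
    (μ : W → ℝ) :
    ∑ p, coneFun (n := N + 1) α l μ p =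
      ∑ x, α x + ∑ w, ∑ x, ∑ j ∈ Finset.range N, l w x (j + 1) + ∑ w, μ w := by
  rw [← (equivSum V W fun _ => N + 1).symm.sum_comp, Fintype.sum_sum_type,
    Fintype.sum_sum_type, Fintype.sum_sigma]
  simp only [Fintype.sum_prod_type]
  rw [add_assoc]
  congr 2
  refine Finset.sum_congr rfl fun w _ => Finset.sum_congr rfl fun x _ => ?_
  have h1 := Finset.sum_subtype (F := inferInstance) (p := fun i : Fin (N + 1) => 0 < (i : ℕ))
    (Finset.univ.filter fun i : Fin (N + 1) => 0 < (i : ℕ)) (by simp) (fun i => l w x i)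
  refine Eq.trans ?_ (h1.symm.trans ?_)
  · rfl
  · rw [Finset.sum_filter, Fin.sum_univ_succ, Finset.sum_range]
    simp

end GenConeVertex

open GenConeVertex

variable {V : Type u} {W : Type v} {G : SimpleGraph V} {H : SimpleGraph W} {n : ℕ}

theorem isIndepSet_coneSet {B : Set V} {L : W → ℕ → Set V} {Q : Set W} (hL : ∀ w, L w 0 = B)
    (hB : G.IsIndepSet B) (hs : ∀ w i, i + 1 < n → G.NoEdgesBetween (L w i) (L w (i + 1)))
    (hQL : ∀ w ∈ Q, ∀ i, i + 1 = n → L w i = ∅) (hQ : H.IsIndepSet Q) :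
    (G.genCone H fun _ => n).IsIndepSet (coneSet B L Q) := by
  have hQ' : ∀ w, ofCopy (V := V) (h := fun _ => n) w none ∈ coneSet B L Q ↔ w ∈ Q :=
    fun w => Iff.rfl
  rw [← noEdgesBetween_self_iff]
  rintro a ha b hb (⟨w, p, q, hpq, rfl, rfl⟩ | ⟨w, w', hw, rfl, rfl⟩)
  · rcases p with _ | ⟨x, i⟩ <;> rcases q with _ | ⟨y, j⟩
    · exact hpq
    · rw [ofCopy_some_mem_coneSet hL, hQL w ((hQ' w).1 ha) j hpq] at hb
      exact hb
    · rw [ofCopy_some_mem_coneSet hL, hQL w ((hQ' w).1 hb) i hpq] at ha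
      exact ha
    · rw [ofCopy_some_mem_coneSet hL] at ha hb
      obtain ⟨hxy, hij | hij | ⟨hi, hj⟩⟩ := hpq
      · rw [← hij] at hb
        exact hs w i (hij ▸ j.2) x ha y hb hxy
      · rw [← hij] at ha
        exact hs w j (hij ▸ i.2) y hb x ha hxy.symm
      · rw [hi, hL] at ha
        rw [hj, hL] at hb
        exact noEdgesBetween_self_iff.2 hB x ha y hb hxy
  · exact noEdgesBetween_self_iff.2 hQ w ha w' hb hw

/-- The `i`th layer, in the copy belonging to `w`, of a set of vertices of the cone. -/
def slice (I : Set (GenConeVertex V W fun _ => n)) (w : W) (i : ℕ) : Set V :=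
  {x | ∃ h : i < n, ofCopy (h := fun _ => n) w (some (x, ⟨i, h⟩)) ∈ I}

/-- Slices with index at least `n` are empty, so the chain conditions hold beyond the last layer
too. -/
theorem isChain_slice {I : Set (GenConeVertex V W fun _ => n)}
    (hI : (G.genCone H fun _ => n).IsIndepSet I) (w : W) : G.IsChain (slice I w) := by
  rw [← noEdgesBetween_self_iff] at hI
  refine ⟨?_, fun i => ?_⟩
  · rintro x ⟨h, hx⟩ y ⟨_, hy⟩ hxy
    exact hI _ hx _ hy (Or.inl ⟨w, some (x, ⟨0, h⟩), some (y, ⟨0, h⟩),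
      ⟨hxy, Or.inr (Or.inr ⟨rfl, rfl⟩)⟩, rfl, rfl⟩)
  · rintro x ⟨h, hx⟩ y ⟨h', hy⟩ hxy
    exact hI _ hx _ hy (Or.inl ⟨w, some (x, ⟨i, h⟩), some (y, ⟨i + 1, h'⟩),
      ⟨hxy, Or.inl rfl⟩, rfl, rfl⟩)

theorem slice_eq_empty_of_apex_mem {N : ℕ} {I : Set (GenConeVertex V W fun _ => N + 1)}
    (hI : (G.genCone H fun _ => N + 1).IsIndepSet I) {w : W} (hw : apex w ∈ I) :
    slice I w N = ∅ := by
  rw [← noEdgesBetween_self_iff] at hI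
  refine Set.eq_empty_of_forall_notMem ?_
  rintro x ⟨h, hx⟩
  exact hI _ hx _ hw (Or.inl ⟨w, some (x, ⟨N, h⟩), none, rfl, rfl, rfl⟩)

theorem eq_coneSet_slice {N : ℕ} (I : Set (GenConeVertex V W fun _ => N + 1)) :
    I = coneSet {x | base x ∈ I} (slice I) {w | apex w ∈ I} := by
  ext (x | ⟨w, x, i, hi⟩ | w)
  · rfl
  · have : ofCopy (h := fun _ => N + 1) w (some (x, i)) = inner w x i hi := by
      simp [ofCopy, hi]
    simp only [coneSet, slice, Set.mem_ofPred_eq, this, Fin.eta, Fin.is_lt, exists_true_left]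
  · rfl

theorem slice_zero {N : ℕ} (I : Set (GenConeVertex V W fun _ => N + 1)) (w : W) :
    slice I w 0 = {x | base x ∈ I} := by
  ext x
  simp [slice, ofCopy]

/-! ### The lower bound -/

/-- The lower bound for the fractional chromatic number of the `(H, n)`-cone that is obtained
from a fractional clique of weight `t` of `H`. -/
theorem le_fractionalChromaticNumber_genCone [Fintype V] [Fintype W] [Nonempty V] [Nonempty W]
    {N : ℕ} {h : W → ℝ} (hh : H.IsFractionalClique h) {t : ℝ} (ht : ∑ w, h w = t)
    (hcond : t = 1 ∨ Odd (N + 1) ∧ 2 ≤ G.fractionalChromaticNumber)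
    (hM : 0 < t * (∑ k ∈ Finset.range (N + 1), (G.fractionalChromaticNumber - 1) ^ k) + 1 - t) :
    G.fractionalChromaticNumber + t /
        (t * (∑ k ∈ Finset.range (N + 1), (G.fractionalChromaticNumber - 1) ^ k) + 1 - t) ≤
      (G.genCone H fun _ => N + 1).fractionalChromaticNumber := by
  classical
  obtain ⟨g, hg, hga⟩ := G.exists_isFractionalClique
  set a := G.fractionalChromaticNumber with ha
  set q := a - 1 with hq
  set S := ∑ k ∈ Finset.range (N + 1), q ^ k with hS
  -- The copies together give the shared base `t * q ^ N`; the correction `1 - t` cancels the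
  -- multiples of `setWeight g B` that the odd case leaves over.
  let β : ℝ := t * q ^ N + 1 - t
  let y : ℕ → ℝ := fun i => q ^ (N - i)
  let c : GenConeVertex V W (fun _ => N + 1) → ℝ :=
    coneFun (fun x => β * g x) (fun w x i => h w * (y i * g x)) h
  have : Nonempty (GenConeVertex V W fun _ => N + 1) := ⟨base (Classical.arbitrary V)⟩
  have htot : ∑ p, c p = a * (t * S + 1 - t) + t := by
    have hS' : S = q ^ N + ∑ j ∈ Finset.range N, y (j + 1) := by
      rw [hS, Finset.sum_range_succ, add_comm, ← Finset.sum_range_reflect]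
      congr 1
      refine Finset.sum_congr rfl fun j hj => ?_
      simp only [y]
      congr 1
      omega
    simp only [c]
    rw [sum_coneFun, ← Finset.mul_sum, hga, ht]
    have h1 : ∑ w, ∑ x, ∑ j ∈ Finset.range N, h w * (y (j + 1) * g x) =
        t * (a * ∑ j ∈ Finset.range N, y (j + 1)) := by
      simp only [← Finset.mul_sum, ← Finset.sum_mul, ht, hga]
      ring
    rw [h1, hS']
    simp only [β]
    ring
  have key : ∑ p, c p ≤ (t * S + 1 - t) *
      (G.genCone H fun _ => N + 1).fractionalChromaticNumber := by
    refine sum_le_mul_fractionalChromaticNumber fun I hI => ?_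
    set B : Set V := {x | base x ∈ I} with hBdef
    set Q : Set W := {w | apex w ∈ I} with hQdef
    have hB1 : setWeight g B ≤ 1 := by
      refine hg.setWeight_le_one fun x hx y hy _ hxy => ?_
      obtain ⟨w⟩ := ‹Nonempty W›
      exact (isChain_slice hI w).zero x (by rwa [slice_zero]) y (by rwa [slice_zero]) hxy
    have hB0 : 0 ≤ setWeight g B := setWeight_nonneg hg.nonneg B
    have hQ1 : ∑ w, h w * Q.indicator 1 w ≤ 1 := by
      refine hh.sum_indicator_le Q fun w hw w' hw' hne hadj => ?_
      exact noEdgesBetween_self_iff.2 hI _ hw _ hw' (Or.inr ⟨w, w', hadj, rfl, rfl⟩)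
    have hval : ∑ p, c p * I.indicator 1 p = (1 - t) * setWeight g B +
        ∑ w, h w * (chainWeight g q (slice I w) (N + 1) + Q.indicator 1 w) := by
      have h1 : ∀ p, c p * I.indicator 1 p =
          coneFun (n := N + 1) (fun x => β * (g x * B.indicator 1 x))
            (fun w x i => h w * (y i * (g x * (slice I w i).indicator 1 x)))
            (fun w => h w * Q.indicator 1 w) p := by
        intro p
        rw [eq_coneSet_slice I, indicator_coneSet]
        rw [← eq_coneSet_slice I]
        rcases p with x | ⟨w, x, i, hi⟩ | w <;> simp only [c, coneFun] <;> ring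
      rw [Finset.sum_congr rfl fun p _ => h1 p, sum_coneFun, ← Finset.mul_sum]
      have h2 : ∀ w, ∑ x, ∑ j ∈ Finset.range N,
          h w * (y (j + 1) * (g x * (slice I w (j + 1)).indicator 1 x)) =
          h w * ∑ j ∈ Finset.range N, q ^ (N - 1 - j) * setWeight g (slice I w (j + 1)) := by
        intro w
        rw [Finset.sum_comm, Finset.mul_sum]
        refine Finset.sum_congr rfl fun j _ => ?_
        rw [← Finset.mul_sum, ← Finset.mul_sum]
        simp only [y, setWeight]
        congr 3
        omega
      simp only [h2, chainWeight_succ_eq_sum, slice_zero, mul_add, Finset.sum_add_distrib,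
        ← Finset.sum_mul, ht]
      change β * setWeight g B + _ + _ = _
      simp only [β]
      ring
    rw [hval]
    have happ : ∀ w, chainWeight g q (slice I w) (N + 1) + Q.indicator 1 w ≤ S := by
      intro w
      by_cases hw : w ∈ Q
      · rw [Set.indicator_of_mem hw]
        exact (isChain_slice hI w).chainWeight_succ_add_one_le hg N
          (slice_eq_empty_of_apex_mem hI hw)
      · rw [Set.indicator_of_notMem hw, add_zero]
        exact (isChain_slice hI w).chainWeight_le hg (N + 1)
    rcases hcond with h1 | ⟨hodd, ha2⟩
    · rw [h1] at ht ⊢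
      calc _ ≤ (1 - 1) * setWeight g B + ∑ w, h w * S := by
            gcongr _ + ?_
            exact Finset.sum_le_sum fun w _ => mul_le_mul_of_nonneg_left (happ w) (hh.nonneg w)
        _ = _ := by rw [← Finset.sum_mul, ht]; ring
    -- The bounds with and without the apex combine into one affine in the indicator of `Q`, so only
    -- the weight of `Q`, at most `1`, enters.
    · have happ' : ∀ w, chainWeight g q (slice I w) (N + 1) + Q.indicator 1 w ≤
          S - 1 + setWeight g B + (1 - setWeight g B) * Q.indicator 1 w := by
        intro w
        by_cases hw : w ∈ Q
        · have := happ w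
          rw [Set.indicator_of_mem hw] at this ⊢
          simp only [Pi.one_apply] at this ⊢
          linarith
        · obtain ⟨k, hk⟩ := hodd
          have := (isChain_slice hI w).chainWeight_odd_le hg ha2 k
          rw [← hk, slice_zero] at this
          rw [Set.indicator_of_notMem hw]
          linarith
      calc _ ≤ (1 - t) * setWeight g B + ∑ w, h w *
            (S - 1 + setWeight g B + (1 - setWeight g B) * Q.indicator 1 w) := by
            gcongr _ + ?_
            exact Finset.sum_le_sum fun w _ => mul_le_mul_of_nonneg_left (happ' w) (hh.nonneg w)
        _ = (1 - t) * setWeight g B + (t * (S - 1 + setWeight g B) +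
            (1 - setWeight g B) * ∑ w, h w * Q.indicator 1 w) := by
            rw [← ht, Finset.sum_mul, Finset.mul_sum, ← Finset.sum_add_distrib]
            congr 1
            exact Finset.sum_congr rfl fun w _ => by ring
        _ ≤ (1 - t) * setWeight g B + (t * (S - 1 + setWeight g B) +
            (1 - setWeight g B) * 1) := by
            have : 0 ≤ 1 - setWeight g B := sub_nonneg.2 hB1
            gcongr
        _ = _ := by ring
  rw [htot] at key
  rw [← sub_nonneg]
  have h2 : (G.genCone H fun _ => N + 1).fractionalChromaticNumber -
      (a + t / (t * S + 1 - t)) = ((t * S + 1 - t) *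
      (G.genCone H fun _ => N + 1).fractionalChromaticNumber -
        (a * (t * S + 1 - t) + t)) / (t * S + 1 - t) := by
    field_simp
  rw [h2]
  exact div_nonneg (sub_nonneg.2 key) hM.le

/-! ### Families of independent sets of the cone -/

open GenConeVertex

/-- The share `α` in the `i`th layer of the sets that are copies of one independent set in the
layers `0, …, j`, and alternately empty and full in the later ones. -/
noncomputable def typeShare (α : ℝ) (j i : ℕ) : ℝ :=
  if i ≤ j then α else if Even (i + j) then 1 else 0

section Types

-- The apex acts as a layer `n`, used only in copies from `Q`. If `n + j` is even, `j < n` puts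
-- layer `n - 1` beyond `j`, where it is empty; `j'` needs no bound, as no apex is used there.
open Classical in
theorem coneFun_typeShare_mem {V : Type u} {W : Type v} {G : SimpleGraph V} {H : SimpleGraph W}
    {n : ℕ} {α : ℝ} (hα : (fun _ => α) ∈ G.stablePolytope) {Q : Set W} (hQ : H.IsIndepSet Q)
    {j : ℕ} (hj : j < n) (j' : ℕ) :
    coneFun (fun _ => α) (fun w _ i => if w ∈ Q then typeShare α j i else typeShare α j' i)
      (fun w => if w ∈ Q then (if Even (n + j) then 1 else 0) else 0) ∈
        (G.genCone H fun _ => n).stablePolytope := by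
  let μ : W → ℝ := fun w => if w ∈ Q then (if Even (n + j) then 1 else 0) else 0
  let J : W → ℕ := fun w => if w ∈ Q then j else j'
  have hJ : ∀ w i, (if w ∈ Q then typeShare α j i else typeShare α j' i) =
      typeShare α (J w) i := by
    intro w i
    simp only [J]
    split_ifs <;> rfl
  simp only [hJ]
  refine map_mem_of_mem_stablePolytope (G := G) convex_stablePolytope
    (fun u => coneFun u (fun w x i => typeShare (u x) (J w) i) μ) (fun u v s t hst => ?_)
    (fun I hI => ?_) hα
  · have h1 : ∀ r : ℝ, r = s * r + t * r := fun r => by rw [← add_mul, hst, one_mul]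
    ext (x | ⟨w, x, i, hi⟩ | w)
    · rfl
    · change typeShare (s * u x + t * v x) (J w) i =
        s * typeShare (u x) (J w) i + t * typeShare (v x) (J w) i
      unfold typeShare
      split_ifs
      · rfl
      · exact h1 1
      · exact h1 0
    · exact h1 _
  · let Q' : Set W := {w | w ∈ Q ∧ Even (n + j)}
    let L : W → ℕ → Set V := fun w i => {x | (i ≤ J w ∧ x ∈ I) ∨ (J w < i ∧ Even (i + J w))}
    have hind : (G.genCone H fun _ => n).IsIndepSet (coneSet I L Q') := by
      refine isIndepSet_coneSet (fun w => ?_) hI (fun w i _ => ?_) (fun w hw i hi => ?_)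
        (hQ.subset_of fun w hw => hw.1)
      · ext x
        simp [L]
      · rintro x (⟨hi, hx⟩ | ⟨hi, hx⟩) y (⟨hi', hy⟩ | ⟨hi', hy⟩) hxy
        · exact hI hx hy hxy.ne hxy
        · obtain ⟨k, hk⟩ := hy
          omega
        · omega
        · obtain ⟨k, hk⟩ := hx
          obtain ⟨k', hk'⟩ := hy
          omega
      · obtain ⟨hwQ, k, hk⟩ := hw
        have hJw : J w = j := if_pos hwQ
        refine Set.eq_empty_of_forall_notMem ?_
        rintro x (⟨h, -⟩ | ⟨h, k', hk'⟩) <;> omega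
    have := indicator_mem_stablePolytope hind
    rw [indicator_coneSet] at this
    convert this using 1
    ext (x | ⟨w, x, i, hi⟩ | w)
    · rfl
    · change typeShare (I.indicator 1 x) (J w) i = (L w i).indicator 1 x
      by_cases h1 : (i : ℕ) ≤ J w
      · by_cases hx : x ∈ I <;> simp [typeShare, h1, L, Set.indicator, hx, h1.not_gt]
      · by_cases h2 : Even ((i : ℕ) + J w) <;>
          simp [typeShare, h1, L, Set.indicator, h2, lt_of_not_ge h1]
    · change μ w = Q'.indicator 1 w
      by_cases h1 : w ∈ Q <;> by_cases h2 : Even (n + j) <;>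
        simp [μ, Q', h1, h2, Set.indicator]

open Classical in
theorem coneFun_average_mem {V : Type u} {W : Type v} {G : SimpleGraph V} {H : SimpleGraph W}
    {n : ℕ} {α : ℝ} (hα : (fun _ => α) ∈ G.stablePolytope) {Q : Set W} (hQ : H.IsIndepSet Q)
    {π π' : ℕ → ℝ} (hπ : ∀ j, 0 ≤ π j) (hπ1 : ∑ j ∈ Finset.range n, π j = 1)
    (hπ' : ∀ j, 0 ≤ π' j) (hπ1' : ∑ j ∈ Finset.range n, π' j = 1) :
    coneFun (fun _ => α) (fun w _ i => if w ∈ Q then ∑ j ∈ Finset.range n, π j * typeShare α j i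
        else ∑ j ∈ Finset.range n, π' j * typeShare α j i)
      (fun w => if w ∈ Q then ∑ j ∈ Finset.range n, π j * (if Even (n + j) then 1 else 0) else 0) ∈
        (G.genCone H fun _ => n).stablePolytope := by
  have h1 : ∀ j < n, coneFun (fun _ => α) (fun w _ i => if w ∈ Q then typeShare α j i else
      ∑ j' ∈ Finset.range n, π' j' * typeShare α j' i)
      (fun w => if w ∈ Q then (if Even (n + j) then 1 else 0) else 0) ∈
        (G.genCone H fun _ => n).stablePolytope := by
    intro j hj
    have := convex_stablePolytope.sum_mem (fun j' _ => hπ' j') hπ1'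
      fun j' _ => coneFun_typeShare_mem (H := H) hα hQ hj j'
    convert this using 1
    ext p
    rw [Finset.sum_apply]
    simp only [Pi.smul_apply, smul_eq_mul]
    rcases p with x | ⟨w, x, i, hi⟩ | w
    · simp only [coneFun, ← Finset.sum_mul, hπ1', one_mul]
    · by_cases hw : w ∈ Q <;> simp only [coneFun, hw, if_true, if_false]
      rw [← Finset.sum_mul, hπ1', one_mul]
    · simp only [coneFun, ← Finset.sum_mul, hπ1', one_mul]
  have := convex_stablePolytope.sum_mem (fun j _ => hπ j) hπ1
    fun j hj => h1 j (Finset.mem_range.1 hj)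
  convert this using 1
  ext p
  rw [Finset.sum_apply]
  simp only [Pi.smul_apply, smul_eq_mul]
  rcases p with x | ⟨w, x, i, hi⟩ | w
  · simp only [coneFun, ← Finset.sum_mul, hπ1, one_mul]
  · by_cases hw : w ∈ Q <;> simp only [coneFun, hw, if_true, if_false]
    rw [← Finset.sum_mul, hπ1, one_mul]
  · by_cases hw : w ∈ Q <;> simp only [coneFun, hw, if_true, if_false]
    simp

/-- The shares in `coneFun_average_mem` are affine in the indicator of `Q`, so `Q` may be random,
containing each vertex of `H` with probability `θ`. -/
theorem coneFun_mixture_mem {V : Type u} {W : Type v} {G : SimpleGraph V} {H : SimpleGraph W}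
    {n : ℕ} {α θ : ℝ} (hα : (fun _ => α) ∈ G.stablePolytope)
    (hθ : (fun _ => θ) ∈ H.stablePolytope)
    {π π' : ℕ → ℝ} (hπ : ∀ j, 0 ≤ π j) (hπ1 : ∑ j ∈ Finset.range n, π j = 1)
    (hπ' : ∀ j, 0 ≤ π' j) (hπ1' : ∑ j ∈ Finset.range n, π' j = 1) :
    coneFun (fun _ => α)
      (fun _ _ i => ∑ j ∈ Finset.range n, (θ * π j + (1 - θ) * π' j) * typeShare α j i)
      (fun _ => ∑ j ∈ Finset.range n, θ * π j * (if Even (n + j) then 1 else 0)) ∈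
        (G.genCone H fun _ => n).stablePolytope := by
  classical
  have := map_mem_of_mem_stablePolytope (G := H)
    (convex_stablePolytope (G := G.genCone H fun _ => n))
    (fun v => coneFun (fun _ => α)
      (fun w _ i => v w * (∑ j ∈ Finset.range n, π j * typeShare α j i) +
        (1 - v w) * (∑ j ∈ Finset.range n, π' j * typeShare α j i))
      (fun w => v w * ∑ j ∈ Finset.range n, π j * (if Even (n + j) then 1 else 0)))
    (fun u v s t hst => ?_) (fun Q hQ => ?_) hθ
  · convert this using 2
    · ext w x i
      rw [Finset.mul_sum, Finset.mul_sum, ← Finset.sum_add_distrib]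
      exact Finset.sum_congr rfl fun j _ => by ring
    · ext w
      rw [Finset.mul_sum]
      exact Finset.sum_congr rfl fun j _ => by ring
  · obtain rfl : t = 1 - s := by linarith
    ext (x | ⟨w, x, i, hi⟩ | w) <;>
      simp only [coneFun, Pi.add_apply, Pi.smul_apply, smul_eq_mul] <;> ring
  · convert coneFun_average_mem (H := H) hα hQ hπ hπ1 hπ' hπ1' using 1
    ext (x | ⟨w, x, i, hi⟩ | w)
    · rfl
    · by_cases hw : w ∈ Q <;> simp [coneFun, hw]
    · by_cases hw : w ∈ Q <;> simp [coneFun, hw]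

-- For odd `n` the last layer is empty, so apices over an independent set of `H` can be added.
open Classical in
theorem coneFun_alternating_mem {V : Type u} {W : Type v} {G : SimpleGraph V}
    {H : SimpleGraph W} {n : ℕ} {r : ℝ} (hr : (fun _ => r) ∈ H.stablePolytope) :
    coneFun (fun _ => 0) (fun _ _ i => if Odd i then 1 else 0)
      (fun _ => if Odd n then r else 0) ∈ (G.genCone H fun _ => n).stablePolytope := by
  refine map_mem_of_mem_stablePolytope (G := H)
    (convex_stablePolytope (G := G.genCone H fun _ => n))
    (fun v => coneFun (fun _ => 0) (fun _ _ i => if Odd i then 1 else 0)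
      (fun w => if Odd n then v w else 0)) (fun u v s t hst => ?_) (fun Q hQ => ?_) hr
  · obtain rfl : t = 1 - s := by linarith
    ext (x | ⟨w, x, i, hi⟩ | w) <;>
      simp only [coneFun, Pi.add_apply, Pi.smul_apply, smul_eq_mul]
    · ring
    · ring
    · split_ifs <;> ring
  · have hind : (G.genCone H fun _ => n).IsIndepSet
        (coneSet ∅ (fun _ i => {_x | Odd i}) {w | w ∈ Q ∧ Odd n}) := by
      refine isIndepSet_coneSet (fun w => ?_) (by simp [IsIndepSet]) (fun w i _ => ?_)
        (fun w hw i hi => ?_) (hQ.subset_of fun w hw => hw.1)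
      · simp
      · rintro x ⟨k, hk⟩ y ⟨k', hk'⟩ hxy
        omega
      · obtain ⟨-, k, hk⟩ := hw
        refine Set.eq_empty_of_forall_notMem ?_
        rintro x ⟨k', hk'⟩
        omega
    have := indicator_mem_stablePolytope hind
    rw [indicator_coneSet] at this
    convert this using 1
    ext (x | ⟨w, x, i, hi⟩ | w)
    · simp [coneFun]
    · simp [coneFun, Set.indicator]
    · by_cases hw : w ∈ Q <;> by_cases hn : Odd n <;> simp [coneFun, Set.indicator, hw, hn]

end Types

/-! ### The weights of the mixture and the upper bound -/

section Weights

/-- Every non-negative weighting is a multiple of a probability weighting. -/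
theorem exists_probability_weights {n : ℕ} (hn : 0 < n) {p : ℕ → ℝ} (hp : ∀ j, 0 ≤ p j) {θ : ℝ}
    (hθ : ∑ j ∈ Finset.range n, p j = θ) :
    ∃ π : ℕ → ℝ, (∀ j, 0 ≤ π j) ∧ ∑ j ∈ Finset.range n, π j = 1 ∧
      ∀ j ∈ Finset.range n, θ * π j = p j := by
  have h0 : 0 ≤ θ := hθ ▸ Finset.sum_nonneg fun j _ => hp j
  rcases h0.eq_or_lt with h | h
  · refine ⟨fun j => if j = 0 then 1 else 0, fun j => by positivity, by simp [hn], fun j hj => ?_⟩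
    rw [← h] at hθ ⊢
    rw [zero_mul, (Finset.sum_eq_zero_iff_of_nonneg fun j _ => hp j).1 hθ j hj]
  · refine ⟨fun j => p j / θ, fun j => div_nonneg (hp j) h.le, ?_, fun j _ => ?_⟩
    · rw [← Finset.sum_div, hθ, div_self h.ne']
    · rw [mul_div_cancel₀ _ h.ne']

/-- As `(q + 1) * q ^ j = q ^ j + q ^ (j + 1)`, the terms `j = i - 2, i - 4, …` cover the exponents
below `i` in pairs; for odd `i` the exponent `0` is left over. -/
theorem sum_even_add_indicator_odd (q : ℝ) (i : ℕ) :
    ∑ j ∈ Finset.range i, (if Even (i + j) then (q + 1) * q ^ j else 0) +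
      (if Odd i then 1 else 0) = ∑ k ∈ Finset.range i, q ^ k := by
  induction i using Nat.twoStepInduction with
  | zero => simp
  | one => simp
  | more i ih _ =>
    rw [Finset.sum_range_succ _ (i + 1), Finset.sum_range_succ _ i,
      Finset.sum_range_succ _ (i + 1), Finset.sum_range_succ _ i, ← ih]
    have h1 : ∀ j, Even (i + 2 + j) ↔ Even (i + j) := fun j => by
      rw [Nat.even_iff, Nat.even_iff]; omega
    have h2 : Odd (i + 2) ↔ Odd i := by rw [Nat.odd_iff, Nat.odd_iff]; omega
    have h3 : Even (i + i) := ⟨i, rfl⟩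
    have h4 : ¬ Even (i + (i + 1)) := by rw [Nat.even_iff]; omega
    simp only [h1, h2, h3, h4, if_true, if_false]
    ring

end Weights

/-- The upper bound for the fractional chromatic number of the `(H, n)`-cone. -/
theorem fractionalChromaticNumber_genCone_le {V : Type u} {W : Type v} [Fintype V] [Fintype W]
    [Nonempty V] [Nonempty W] {G : SimpleGraph V} {H : SimpleGraph W} {N : ℕ} {ρ S m : ℝ}
    (hS : S = ∑ k ∈ Finset.range (N + 1), (G.fractionalChromaticNumber - 1) ^ k)
    (hρ : ρ = S + if Odd (N + 1) then 1 / H.fractionalChromaticNumber - 1 else 0)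
    (hm : m = S - if Odd (N + 1) then 1 else 0)
    (hρ0 : 0 < ρ)
    (hlast : ∑ k ∈ Finset.range N, (G.fractionalChromaticNumber - 1) ^ k ≤ ρ)
    (hmb : H.fractionalChromaticNumber * m ≤ G.fractionalChromaticNumber * ρ) :
    (G.genCone H fun _ => N + 1).fractionalChromaticNumber ≤
      G.fractionalChromaticNumber + 1 / ρ := by
  have ha1 : 1 ≤ G.fractionalChromaticNumber := one_le_fractionalChromaticNumber
  have hb1 : 1 ≤ H.fractionalChromaticNumber := one_le_fractionalChromaticNumber
  have hα := const_mem_stablePolytope (G := G)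
  have hβ := const_mem_stablePolytope (G := H)
  have hθH := fun {r : ℝ} (h0 : 0 ≤ r) (h : r ≤ 1 / H.fractionalChromaticNumber) =>
    const_mem_stablePolytope_of_le (G := H) h0 h
  set a := G.fractionalChromaticNumber
  set b := H.fractionalChromaticNumber
  have ha0 : 0 < a := by linarith
  have hb0 : 0 < b := by linarith
  set q := a - 1 with hq
  have hq0 : 0 ≤ q := by linarith
  have haq : q + 1 = a := by ring
  -- The weight of type `j`. The last type brings the total to `a * ρ`, so that share `1 / a` covers
  -- the base `ρ` times.
  let p : ℕ → ℝ := fun j =>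
    if j < N then a * q ^ j else a * (ρ - ∑ k ∈ Finset.range N, q ^ k)
  have hp0 : ∀ j, 0 ≤ p j := by
    intro j
    simp only [p]
    split_ifs
    · positivity
    · exact mul_nonneg ha0.le (sub_nonneg.2 hlast)
  have hpN : p N = a * (ρ - ∑ k ∈ Finset.range N, q ^ k) := if_neg (lt_irrefl N)
  have hplt : ∀ j ∈ Finset.range N, p j = a * q ^ j := fun j hj => if_pos (Finset.mem_range.1 hj)
  have hpsum : ∑ j ∈ Finset.range (N + 1), p j = a * ρ := by
    rw [Finset.sum_range_succ, hpN, Finset.sum_congr rfl hplt, ← Finset.mul_sum]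
    ring
  let e : ℕ → ℝ := fun j => if Even (N + 1 + j) then 1 else 0
  have hNe : ¬ Even (N + 1 + N) := by rw [Nat.even_iff]; omega
  have hpe : ∑ j ∈ Finset.range (N + 1), p j * e j = m := by
    rw [hm, hS, ← sum_even_add_indicator_odd, add_sub_cancel_right, Finset.sum_range_succ,
      Finset.sum_range_succ]
    simp only [e, hNe, if_false, mul_zero, add_zero, haq]
    refine Finset.sum_congr rfl fun j hj => ?_
    rw [hplt j hj]
    split_ifs <;> simp
  have he0 : ∀ j, 0 ≤ e j := fun j => by simp only [e]; positivity
  have he1 : ∀ j, e j ≤ 1 := fun j => by simp only [e]; split_ifs <;> norm_num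
  have hm0 : 0 ≤ m := hpe ▸ Finset.sum_nonneg fun j _ => mul_nonneg (hp0 j) (he0 j)
  set θ := m / (a * ρ) with hθ
  have haρ : 0 < a * ρ := mul_pos ha0 hρ0
  -- Types with `e j = 1` leave the last layer empty and go to copies in `Q`, the others to the
  -- remaining copies.
  obtain ⟨π, hπ0, hπ1, hπ⟩ := exists_probability_weights (n := N + 1) (Nat.succ_pos N)
    (p := fun j => p j * e j / (a * ρ)) (θ := θ)
    (fun j => div_nonneg (mul_nonneg (hp0 j) (he0 j)) haρ.le) (by rw [← Finset.sum_div, hpe])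
  obtain ⟨π', hπ0', hπ1', hπ'⟩ := exists_probability_weights (n := N + 1) (Nat.succ_pos N)
    (p := fun j => p j * (1 - e j) / (a * ρ)) (θ := 1 - θ)
    (fun j => div_nonneg (mul_nonneg (hp0 j) (sub_nonneg.2 (he1 j))) haρ.le) (by
      rw [← Finset.sum_div]
      simp only [mul_sub, mul_one, Finset.sum_sub_distrib, hpe, hpsum]
      rw [sub_div, div_self haρ.ne'])
  have hA := coneFun_mixture_mem (H := H) hα
    (hθH (r := θ) (by positivity) (by
      rw [hθ, div_le_div_iff₀ haρ hb0]
      linarith)) hπ0 hπ1 hπ0' hπ1'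
  have hZ := coneFun_alternating_mem (G := G) (n := N + 1) hβ
  -- Weight `1` for the alternating sets and `a * ρ` for the mixture: before normalisation every
  -- vertex is covered exactly `ρ` times.
  have hmix := convex_stablePolytope hZ hA (a := 1 / (1 + a * ρ)) (b := a * ρ / (1 + a * ρ))
    (by positivity) (by positivity) (by field_simp)
  have hgoal : a + 1 / ρ = 1 / (ρ / (1 + a * ρ)) := by
    field_simp
    ring
  rw [hgoal]
  refine fractionalChromaticNumber_le_of_mem_stablePolytope hmix (by positivity) fun v => ?_
  have hscale : ∀ z y : ℝ, z + a * ρ * y = ρ →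
      ρ / (1 + a * ρ) ≤ 1 / (1 + a * ρ) * z + a * ρ / (1 + a * ρ) * y := by
    intro z y h
    have h1 : 1 / (1 + a * ρ) * z + a * ρ / (1 + a * ρ) * y = (z + a * ρ * y) / (1 + a * ρ) := by
      ring
    rw [h1, h]
  rcases v with x | ⟨w, x, i, hi⟩ | w
  · refine hscale 0 (1 / a) ?_
    field_simp
    ring
  · refine hscale (if Odd (i : ℕ) then 1 else 0) (∑ j ∈ Finset.range (N + 1),
      (θ * π j + (1 - θ) * π' j) * typeShare (1 / a) j i) ?_
    have hiN : (i : ℕ) ≤ N := Nat.lt_succ_iff.1 i.2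
    have h1 : a * ρ * ∑ j ∈ Finset.range (N + 1),
        (θ * π j + (1 - θ) * π' j) * typeShare (1 / a) j i =
        ∑ j ∈ Finset.range (N + 1), p j * typeShare (1 / a) j i := by
      rw [Finset.mul_sum]
      refine Finset.sum_congr rfl fun j hj => ?_
      rw [hπ j hj, hπ' j hj]
      field_simp
      ring
    rw [h1, Finset.sum_range_succ]
    have h2 : p N * typeShare (1 / a) N i = ρ - ∑ k ∈ Finset.range N, q ^ k := by
      rw [hpN, typeShare, if_pos hiN]
      field_simp
    rw [h2, ← Finset.sum_range_add_sum_Ico _ hiN, ← Finset.sum_range_add_sum_Ico _ hiN,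
      ← sum_even_add_indicator_odd q i]
    have h3 : ∑ j ∈ Finset.range i, p j * typeShare (1 / a) j i =
        ∑ j ∈ Finset.range i, (if Even ((i : ℕ) + j) then (q + 1) * q ^ j else 0) := by
      refine Finset.sum_congr rfl fun j hj => ?_
      have hji := Finset.mem_range.1 hj
      rw [hplt j (Finset.mem_range.2 (hji.trans_le hiN)), typeShare, if_neg hji.not_ge, haq]
      split_ifs <;> simp
    have h4 : ∑ j ∈ Finset.Ico (i : ℕ) N, p j * typeShare (1 / a) j i =
        ∑ j ∈ Finset.Ico (i : ℕ) N, q ^ j := by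
      refine Finset.sum_congr rfl fun j hj => ?_
      obtain ⟨hij, hjN⟩ := Finset.mem_Ico.1 hj
      rw [hplt j (Finset.mem_range.2 hjN), typeShare, if_pos hij]
      field_simp
    rw [h3, h4]
    ring
  · refine hscale (if Odd (N + 1) then 1 / b else 0)
      (∑ j ∈ Finset.range (N + 1), θ * π j * e j) ?_
    have h1 : a * ρ * ∑ j ∈ Finset.range (N + 1), θ * π j * e j = m := by
      rw [← hpe, Finset.mul_sum]
      refine Finset.sum_congr rfl fun j hj => ?_
      rw [hπ j hj]
      have : e j * e j = e j := by simp only [e]; split_ifs <;> simp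
      rw [div_mul_eq_mul_div, mul_assoc (p j), this]
      field_simp
    rw [h1, hm, hρ]
    split_ifs <;> ring

end SimpleGraph

/-! ### The theorem -/

theorem theorem2 {V : Type u} {W : Type v} [Fintype V] [Fintype W] [Nonempty W]
    (G : SimpleGraph V) (H : SimpleGraph W)
    (hHG : H.fractionalChromaticNumber ≤ G.fractionalChromaticNumber)
    (n : ℕ) (hn : 0 < n) :
    (Even n →
      (G.genCone H fun _ => n).fractionalChromaticNumber =
        G.fractionalChromaticNumber +
          1 / ∑ k ∈ Finset.range n, (G.fractionalChromaticNumber - 1) ^ k) ∧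
    (Odd n →
      (G.genCone H fun _ => n).fractionalChromaticNumber =
        G.fractionalChromaticNumber + H.fractionalChromaticNumber *
          (1 / (H.fractionalChromaticNumber *
              (∑ k ∈ Finset.range n, (G.fractionalChromaticNumber - 1) ^ k) + 1 -
            H.fractionalChromaticNumber))) := by
  have hb1 : 1 ≤ H.fractionalChromaticNumber := SimpleGraph.one_le_fractionalChromaticNumber
  -- An empty graph has fractional chromatic number at most `0`, but here it is at least that of
  -- `H`, hence at least `1`.
  have : Nonempty V :=
    SimpleGraph.nonempty_of_fractionalChromaticNumber_pos (zero_lt_one.trans_le (hb1.trans hHG))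
  obtain ⟨N, rfl⟩ : ∃ N, n = N + 1 := ⟨n - 1, by omega⟩
  have ha := SimpleGraph.fractionalChromaticNumber_eq_one_or_two_le (G := G)
  obtain ⟨h, hh, hhb⟩ := H.exists_isFractionalClique
  have hupper := SimpleGraph.fractionalChromaticNumber_genCone_le (G := G) (H := H) (N := N)
    rfl rfl rfl
  have hlower := SimpleGraph.le_fractionalChromaticNumber_genCone (G := G) (H := H) (N := N)
    (h := h) hh hhb
  -- The clique rescaled to total `1` serves even `n` and the case `a = 1`.
  have hh' : H.IsFractionalClique fun w => h w / H.fractionalChromaticNumber := by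
    have hb0 : 0 < H.fractionalChromaticNumber := zero_lt_one.trans_le hb1
    refine ⟨fun w => div_nonneg (hh.nonneg w) hb0.le, fun I hI => ?_⟩
    simp only [div_mul_eq_mul_div, ← Finset.sum_div]
    exact (div_le_one hb0).2 ((hh.sum_indicator_le I hI).trans hb1)
  have hlower' := SimpleGraph.le_fractionalChromaticNumber_genCone (G := G) (N := N) hh'
    (t := 1) (by rw [← Finset.sum_div, hhb, div_self (by positivity)]) (Or.inl rfl)
  set a := G.fractionalChromaticNumber
  set b := H.fractionalChromaticNumber
  have hq0 : 0 ≤ a - 1 := by linarith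
  have hSle : ∑ k ∈ Finset.range N, (a - 1) ^ k ≤ ∑ k ∈ Finset.range (N + 1), (a - 1) ^ k := by
    rw [Finset.sum_range_succ]
    have : 0 ≤ (a - 1) ^ N := by positivity
    linarith
  have hS1 : 1 ≤ ∑ k ∈ Finset.range (N + 1), (a - 1) ^ k := by
    rw [geom_sum_succ]
    have : 0 ≤ (a - 1) * ∑ k ∈ Finset.range N, (a - 1) ^ k :=
      mul_nonneg hq0 (Finset.sum_nonneg fun k _ => by positivity)
    linarith
  have hSsucc : ∑ k ∈ Finset.range (N + 1), (a - 1) ^ k =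
      ∑ k ∈ Finset.range N, (a - 1) ^ k + (a - 1) ^ N := Finset.sum_range_succ _ _
  set S := ∑ k ∈ Finset.range (N + 1), (a - 1) ^ k
  rw [one_mul, add_sub_cancel_right] at hlower'
  have hb0 : 0 < b := by linarith
  constructor
  · intro heven
    simp only [Nat.not_odd_iff_even.2 heven, if_false, add_zero, sub_zero] at hupper
    refine le_antisymm (hupper (by linarith) hSle ?_) (hlower' (by linarith))
    exact mul_le_mul_of_nonneg_right hHG (by linarith)
  · intro hodd
    simp only [hodd, if_true] at hupper
    have hinv : 0 < 1 / b := by positivity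
    have hM : 0 < b * S + 1 - b := by nlinarith
    have hform : b * (1 / (b * S + 1 - b)) = 1 / (S + (1 / b - 1)) := by
      have : S + (1 / b - 1) = (b * S + 1 - b) / b := by
        field_simp
        ring
      rw [this, one_div_div, mul_one_div]
    refine le_antisymm ?_ ?_
    · rw [hform]
      refine hupper (by linarith) ?_ ?_
      -- The last type must have non-negative weight: for `a = 1` the correction `1 / b - 1`
      -- vanishes, and for `a ≥ 2` the power `(a - 1) ^ N ≥ 1` outweighs it.
      · rcases ha with ha | ha
        · have hb : b = 1 := le_antisymm (by linarith) hb1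
          rw [hb]
          simpa using hSle
        · have : 1 ≤ (a - 1) ^ N := one_le_pow₀ (by linarith)
          linarith
      · have h1 : 0 < a * (1 / b) := mul_pos (by linarith) hinv
        nlinarith
    · rw [mul_one_div]
      rcases ha with ha | ha
      · have hb : b = 1 := le_antisymm (by linarith) hb1
        rw [hb, one_mul, add_sub_cancel_right]
        exact hlower' (by linarith)
      · exact hlower (Or.inr ⟨hodd, ha⟩) hM
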